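/- Let $A=(a_{ij})\in\mathbb{R}^{m\times n}$ have nonnegative entries and be surjective as a map $\mathbb{R}^n\to\mathbb{R}^m$, let $b\in\mathbb{R}^m$ have positive entries, and let $\epsilon\ge 0$, $\mu>0$, $\delta>0$. With $0\log 0=0$, let $\phi(u)=\sum_i u_i\log u_i$ (equal to $+\infty$ outside the nonnegative orthant), $D_f(x,y)=f(x)-f(y)-\langle\nabla f(y),x-y\rangle$, and $$E(x)=D_\phi(Ax,b)+\tfrac{\epsilon}{2}\|Ax-b\|^2,\qquad h(x)=\sum_{i=1}^n x_i\log x_i+\tfrac{\epsilon}{2}\|x\|^2,\qquad \operatorname{dom}h=\mathbb{R}^n_{\ge0}.$$ Let $\mathcal X_0=\arg\min\{E(x):x\in\overline{\operatorname{dom}h}\}$. Say that (LC) holds with constant $L>0$ if $Lh-E$ is convex on $\operatorname{int}\operatorname{dom}h$, and let $\alpha(h)=\inf\{D_h(x,y)/D_h(y,x): x,y\in\operatorname{int}\operatorname{dom}h,\ x\neq y\}$ (with value $0$ if $n=0$). Consider the iteration $$x^{k+1}=\arg\min_{x}\Big\{\delta\mu\|x\|_1+\langle\overline p^k,x\rangle+\sum_{i=1}^n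 x_i\log x_i+\tfrac{\epsilon}{2}\|x\|^2\Big\},\qquad \overline p^k=\delta\nabla E(x^k)-\nabla h(x^k)-\delta\mu p^k,$$ $$p^{k+1}=p^k-\tfrac{1}{\delta\mu}\big[\nabla h(x^{k+1})-\nabla h(x^k)+\delta\nabla E(x^k)\big],$$ started either at $x^0=p^0=0$, where (for $n\geq 1$, since $0\notin\operatorname{int}\operatorname{dom}h$) the terms $\nabla h(x^0)$ and $\nabla E(x^0)$ are read as $0$, so that $x^1=\arg\min\{\delta\mu\|x\|_1+h(x)\}$; or at any $x^0\in\operatorname{int}\operatorname{dom}h$ and $p^0\in\mathbb{R}^n$ with $\nabla h(x^0)+\delta\mu p^0=0$. Then: 1. (LC) holds with every $L>0$ such that $L\ge\|A\|^2$ (spectral norm) and $L\ge\sum_{i=1}^m a_{ij}$ for all $j$. 2. For every $q\in\mathbb{R}^n$ the function $\delta\mu\|x\|_1+\langle q,x\rangle+\sum_i x_i\log x_i+\frac{\epsilon}{2}\|x\|^2$ has a unique minimizer over $\operatorname{dom}h$, and it lies in $\operatorname{int}\operatorname{dom}h$; so the iteration is well defined. 3. The problem $\min\{\mu\|x\|_1+\frac{\epsilon}{2\delta}\|x\|^2+\frac1\delta\sum_{i=1}^n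 x_i\log x_i:\ x\in\mathcal X_0\}$ has a unique minimizer $\hat x$. If (LC) holds with a constant $L>0$ and $\delta<\frac{1+\alpha(h)-\omega}{L}$ for some $\omega\in(0,1+\alpha(h))$, then every sequence $\{x^k\}$ so generated converges either to $\hat x$ or to a boundary point of $\operatorname{dom}h$. -/

import Mathlib

noncomputable section

namespace LBreg

/-- `ℝⁿ` with the Euclidean norm and inner product. -/
abbrev Vec (n : ℕ) : Type := EuclideanSpace ℝ (Fin n)

/-- The linear operator `x ↦ A x` between Euclidean spaces; its norm is the spectral norm. -/
def linOp {m n : ℕ} (A : Matrix (Fin m) (Fin n) ℝ) : Vec n →L[ℝ] Vec m :=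
  LinearMap.toContinuousLinearMap (Matrix.toEuclideanLin A)

/-- The nonnegative orthant. It is the effective domain of the Boltzmann-Shannon entropy and of
`relFun` below, both of which are `+∞` outside of it. -/
def orthant (n : ℕ) : Set (Vec n) := {x | ∀ i, 0 ≤ x i}

/-- The (finite) values on the orthant of the Boltzmann-Shannon entropy `∑ xᵢ log xᵢ`, where
`0 log 0 = 0`. -/
def entropy {n : ℕ} (x : Vec n) : ℝ := ∑ i, x i * Real.log (x i)

/-- The `ℓ¹` norm. -/
def l1 {n : ℕ} (x : Vec n) : ℝ := ∑ i, |x i|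

/-- The Bregman distance `D_f(x, y) = f(x) - f(y) - ⟨∇f(y), x - y⟩` (used only for `y` at which
`f` is differentiable). -/
def bregman {n : ℕ} (f : Vec n → ℝ) (x y : Vec n) : ℝ :=
  f x - f y - inner ℝ (gradient f y) (x - y)

/-- The relative function `h(x) = ∑ xᵢ log xᵢ + (ε/2) ‖x‖²` on its domain, the orthant. -/
def relFun {n : ℕ} (ε : ℝ) (x : Vec n) : ℝ := entropy x + ε / 2 * ‖x‖ ^ 2

/-- The energy `E(x) = D_φ(Ax, b) + (ε/2) ‖Ax - b‖²`, with `φ` the Boltzmann-Shannon entropy. -/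
def energy {m n : ℕ} (A : Matrix (Fin m) (Fin n) ℝ) (b : Vec m) (ε : ℝ) (x : Vec n) : ℝ :=
  bregman entropy (linOp A x) b + ε / 2 * ‖linOp A x - b‖ ^ 2

/-- The Lipschitz-like convexity condition with constant `L`: the function `L h - E` is convex on
the interior of `dom h`. -/
def LipschitzLike {m n : ℕ} (A : Matrix (Fin m) (Fin n) ℝ) (b : Vec m) (ε L : ℝ) : Prop :=
  ConvexOn ℝ (interior (orthant n)) (fun x => L * relFun ε x - energy A b ε x)

/-- The symmetry coefficient `α(h) = inf { D_h(x,y) / D_h(y,x) : x ≠ y in int dom h }`. -/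
def symCoeff (n : ℕ) (ε : ℝ) : ℝ :=
  sInf {r | ∃ x ∈ interior (orthant n), ∃ y ∈ interior (orthant n),
    x ≠ y ∧ r = bregman (relFun ε) x y / bregman (relFun ε) y x}

/-- The minimizers of `E` over the closure of `dom h`. -/
def X0 {m n : ℕ} (A : Matrix (Fin m) (Fin n) ℝ) (b : Vec m) (ε : ℝ) : Set (Vec n) :=
  {x | x ∈ closure (orthant n) ∧ ∀ z ∈ closure (orthant n), energy A b ε x ≤ energy A b ε z}

/-- `μ ‖x‖₁ + (ε/(2δ)) ‖x‖² + (1/δ) ∑ xᵢ log xᵢ`. -/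
def regObj {n : ℕ} (ε μ δ : ℝ) (x : Vec n) : ℝ :=
  μ * l1 x + ε / (2 * δ) * ‖x‖ ^ 2 + 1 / δ * entropy x

/-- The gradient at the interior points of the orthant. At the other points, where the functions
under consideration have no gradient, a gradient term is by convention omitted (read as `0`);
the iteration can meet such a point only as its starting point. -/
def intGrad {n : ℕ} (f : Vec n → ℝ) (x : Vec n) : Vec n :=
  open Classical in if x ∈ interior (orthant n) then gradient f x else 0

/-- The objective `δ μ ‖x‖₁ + ⟨q, x⟩ + ∑ xᵢ log xᵢ + (ε/2) ‖x‖²` of a subproblem, on its domain,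
the orthant. -/
def subObj {n : ℕ} (ε μ δ : ℝ) (q x : Vec n) : ℝ :=
  δ * μ * l1 x + inner ℝ q x + entropy x + ε / 2 * ‖x‖ ^ 2

/-- The vector `δ ∇E(xᵏ) - ∇h(xᵏ) - δ μ pᵏ` of the linear term of a subproblem. -/
def pbar {m n : ℕ} (A : Matrix (Fin m) (Fin n) ℝ) (b : Vec m) (ε μ δ : ℝ) (x p : Vec n) : Vec n :=
  δ • intGrad (energy A b ε) x - intGrad (relFun ε) x - (δ * μ) • p

/-- The sequences `x`, `p` are produced by the iteration: `xᵏ⁺¹` minimizes the subproblem over the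
orthant, and `pᵏ⁺¹ = pᵏ - (1/(δμ)) (∇h(xᵏ⁺¹) - ∇h(xᵏ) + δ ∇E(xᵏ))`. -/
def IsGenerated {m n : ℕ} (A : Matrix (Fin m) (Fin n) ℝ) (b : Vec m) (ε μ δ : ℝ)
    (x p : ℕ → Vec n) : Prop :=
  ∀ k, (x (k + 1) ∈ orthant n ∧ ∀ z ∈ orthant n,
      subObj ε μ δ (pbar A b ε μ δ (x k) (p k)) (x (k + 1))
        ≤ subObj ε μ δ (pbar A b ε μ δ (x k) (p k)) z) ∧
    p (k + 1) = p k - (1 / (δ * μ)) •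
      (intGrad (relFun ε) (x (k + 1)) - intGrad (relFun ε) (x k)
        + δ • intGrad (energy A b ε) (x k))

/-- Admissible starts. Either `x⁰ = p⁰ = 0` (so that, by the convention in `intGrad`, the first
subproblem is to minimize `δ μ ‖x‖₁ + h(x)`), or `x⁰` is interior and the initial dual
variable `∇h(x⁰) + δ μ p⁰` vanishes. -/
def IsStart {n : ℕ} (ε μ δ : ℝ) (x₀ p₀ : Vec n) : Prop :=
  (x₀ = 0 ∧ p₀ = 0) ∨
    (x₀ ∈ interior (orthant n) ∧ gradient (relFun ε) x₀ + (δ * μ) • p₀ = 0)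

end LBreg

end

noncomputable section

namespace LBreg

open Filter Topology InnerProductSpace

/-! ### The orthant -/

/-! The iteration is mirror descent in disguise. On the orthant `l1` is linear, so the subproblem's
stationarity condition together with the update of `p` says that `∇h(xᵏ) + δμ pᵏ` (`dualVar`) moves
by `-δ∇E(xᵏ)` and that `∇h(xᵏ⁺¹)` differs from it only by the constant vector `δμ·1`
(`IsGenerated.relGrad_succ`).

Convergence: since `α(h) ≤ 0` (`symCoeff_nonpos`), the step size condition forces `δL ≤ 1`. The
Bregman three-point identity, with convexity of `E` and the descent lemma, then makes `D_h(u, xᵏ)`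
decrease for every `u ∈ X0` (`relDiv_le_of_step`). The bound of the divergence below by squared
differences of square roots (`sq_sqrt_sub_le_relDiv`) supplies compactness, and monotonicity
upgrades a cluster point to the limit (`exists_tendsto_of_step`).

Selection: energy gradients lie in the range of `Aᵀ`, and the dual variable starts at `0`, so it
never leaves that range. If the limit is interior, `∇h + δμ·1` is continuous there and its value at
the limit lies in the closed range. As `A` is constant on `X0`, this is the optimality condition of
the regularized problem (`regObj_le_of_relGrad_mem_range`), whose minimizer is unique. -/

theorem isClosed_orthant (n : ℕ) : IsClosed (orthant n) := by
  have : orthant n = ⋂ i, {x : Vec n | 0 ≤ x i} := by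
    ext x; simp [orthant]
  rw [this]
  exact isClosed_iInter fun i => isClosed_le continuous_const (by fun_prop)

theorem closure_orthant (n : ℕ) : closure (orthant n) = orthant n :=
  (isClosed_orthant n).closure_eq

theorem convex_orthant (n : ℕ) : Convex ℝ (orthant n) := by
  intro x hx y hy a b ha hb _ i
  have := mul_nonneg ha (hx i)
  have := mul_nonneg hb (hy i)
  simp only [PiLp.add_apply, PiLp.smul_apply, smul_eq_mul]
  linarith

theorem mem_interior_orthant {n : ℕ} {x : Vec n} :
    x ∈ interior (orthant n) ↔ ∀ i, 0 < x i := by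
  constructor
  · intro hx i
    rw [mem_interior_iff_mem_nhds] at hx
    have hc : Tendsto (fun t : ℝ => x - t • EuclideanSpace.single i (1 : ℝ)) (𝓝 0) (𝓝 x) := by
      have : Continuous (fun t : ℝ => x - t • EuclideanSpace.single i (1 : ℝ)) := by fun_prop
      simpa using this.tendsto 0
    have h1 : ∀ᶠ t : ℝ in 𝓝[>] 0, x - t • EuclideanSpace.single i (1 : ℝ) ∈ orthant n :=
      (hc.eventually hx).filter_mono nhdsWithin_le_nhds
    obtain ⟨t, ht, ht0⟩ := (h1.and self_mem_nhdsWithin).exists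
    have := ht i
    simp only [PiLp.sub_apply, PiLp.smul_apply, PiLp.single_apply, if_true,
      smul_eq_mul, mul_one] at this
    have h0 : 0 < t := ht0
    linarith
  · intro hx
    have ho : IsOpen {y : Vec n | ∀ i, 0 < y i} := by
      have : {y : Vec n | ∀ i, 0 < y i} = ⋂ i, {y : Vec n | 0 < y i} := by ext y; simp
      rw [this]
      exact isOpen_iInter_of_finite fun i => isOpen_lt continuous_const (by fun_prop)
    exact interior_maximal (fun y hy i => (hy i).le) ho hx

theorem mem_orthant_of_pos {n : ℕ} {x : Vec n} (hx : ∀ i, 0 < x i) : x ∈ orthant n :=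
  fun i => (hx i).le

/-! ### The relative function, its gradient and its Bregman distance -/

/-- The gradient of `relFun` at points with positive coordinates. -/
def relGrad {n : ℕ} (ε : ℝ) (x : Vec n) : Vec n :=
  WithLp.toLp 2 fun i => Real.log (x i) + 1 + ε * x i

/-- The Kullback-Leibler divergence plus `(ε/2) ‖u - x‖²`; the Bregman distance of `relFun`. -/
def relDiv {n : ℕ} (ε : ℝ) (u x : Vec n) : ℝ :=
  ∑ i, (u i * Real.log (u i) - u i * Real.log (x i) - u i + x i + ε / 2 * (u i - x i) ^ 2)

@[simp] theorem relGrad_apply {n : ℕ} (ε : ℝ) (x : Vec n) (i : Fin n) :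
    relGrad ε x i = Real.log (x i) + 1 + ε * x i := rfl

theorem inner_eq_sum {n : ℕ} (x y : Vec n) : inner ℝ x y = ∑ i, x i * y i := by
  rw [PiLp.inner_apply]
  exact Finset.sum_congr rfl fun i _ => by simp [mul_comm]

theorem relFun_eq_sum {n : ℕ} (ε : ℝ) (x : Vec n) :
    relFun ε x = ∑ i, (x i * Real.log (x i) + ε / 2 * x i ^ 2) := by
  rw [relFun, entropy, EuclideanSpace.real_norm_sq_eq, Finset.mul_sum, Finset.sum_add_distrib]

theorem continuous_relFun {n : ℕ} (ε : ℝ) : Continuous (relFun ε : Vec n → ℝ) := by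
  have h : (relFun ε : Vec n → ℝ) = fun x => ∑ i, (x i * Real.log (x i) + ε / 2 * x i ^ 2) :=
    funext (relFun_eq_sum ε)
  rw [h]
  refine continuous_finsetSum _ fun i _ => ?_
  have h1 : Continuous fun x : Vec n => x i * Real.log (x i) :=
    Real.continuous_mul_log.comp (by fun_prop : Continuous fun x : Vec n => x i)
  fun_prop

/-- Purely algebraic in the symbols `log (x i)`, hence free of positivity assumptions; positivity
enters only when `relGrad` must be the actual gradient. -/
theorem relFun_eq_add_relDiv {n : ℕ} (ε : ℝ) (u : Vec n) (x : Vec n) :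
    relFun ε u = relFun ε x + inner ℝ (relGrad ε x) (u - x) + relDiv ε u x := by
  rw [relFun_eq_sum, relFun_eq_sum, inner_eq_sum, relDiv, ← Finset.sum_add_distrib,
    ← Finset.sum_add_distrib]
  refine Finset.sum_congr rfl fun i _ => ?_
  simp only [relGrad_apply, PiLp.sub_apply]
  ring

theorem hasGradientAt_relFun {n : ℕ} (ε : ℝ) {x : Vec n} (hx : ∀ i, 0 < x i) :
    HasGradientAt (relFun ε) (relGrad ε x) x := by
  rw [hasGradientAt_iff_hasFDerivAt]
  have h : (relFun ε : Vec n → ℝ) = fun x => ∑ i, (x i * Real.log (x i) + ε / 2 * x i ^ 2) :=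
    funext (relFun_eq_sum ε)
  rw [h]
  have h1 : ∀ i ∈ (Finset.univ : Finset (Fin n)),
      HasFDerivAt (fun x : Vec n => x i * Real.log (x i) + ε / 2 * x i ^ 2)
        ((relGrad ε x i) • (PiLp.proj 2 (fun _ : Fin n => ℝ) i : Vec n →L[ℝ] ℝ)) x := by
    intro i _
    have hd : HasDerivAt (fun t : ℝ => t * Real.log t + ε / 2 * t ^ 2) (relGrad ε x i) (x i) := by
      have h2 := (Real.hasDerivAt_mul_log (hx i).ne').add
        (((hasDerivAt_id (x i)).pow 2).const_mul (ε / 2))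
      refine h2.congr_deriv ?_
      simp only [relGrad_apply, id]
      ring
    have hp : HasFDerivAt (fun y : Vec n => y i)
        (PiLp.proj 2 (fun _ : Fin n => ℝ) i : Vec n →L[ℝ] ℝ) x :=
      PiLp.hasFDerivAt_apply (𝕜 := ℝ) 2 x i
    exact HasDerivAt.comp_hasFDerivAt (h₂ := fun t : ℝ => t * Real.log t + ε / 2 * t ^ 2) x hd hp
  refine (HasFDerivAt.fun_sum h1).congr_fderiv ?_
  ext v
  simp [toDual_apply_apply, inner_eq_sum]

theorem gradient_relFun {n : ℕ} (ε : ℝ) {x : Vec n} (hx : ∀ i, 0 < x i) :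
    gradient (relFun ε) x = relGrad ε x :=
  (hasGradientAt_relFun ε hx).gradient

theorem bregman_relFun {n : ℕ} (ε : ℝ) (u : Vec n) {x : Vec n} (hx : ∀ i, 0 < x i) :
    bregman (relFun ε) u x = relDiv ε u x := by
  rw [bregman, gradient_relFun ε hx, relFun_eq_add_relDiv ε u x]
  ring

/-- Apply `log r ≤ r - 1` at `r = √x / √u` and multiply by `2u`; for `u = 0` both sides equal `x`.
This Hellinger bound is the source of positivity, coercivity and convergence below. -/
theorem sq_sqrt_sub_le {u x : ℝ} (hu : 0 ≤ u) (hx : 0 < x) :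
    (√u - √x) ^ 2 ≤ u * Real.log u - u * Real.log x - u + x := by
  rcases hu.eq_or_lt with rfl | hu
  · simp [Real.sq_sqrt hx.le]
  · have h1 := Real.log_le_sub_one_of_pos (div_pos (Real.sqrt_pos.2 hx) (Real.sqrt_pos.2 hu))
    rw [Real.log_div (Real.sqrt_pos.2 hx).ne' (Real.sqrt_pos.2 hu).ne', Real.log_sqrt hx.le,
      Real.log_sqrt hu.le] at h1
    have h2 := mul_le_mul_of_nonneg_left h1 hu.le
    have h3 : u * (√x / √u - 1) = √u * √x - u := by
      have : √u ≠ 0 := (Real.sqrt_pos.2 hu).ne'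
      nth_rewrite 1 [← Real.mul_self_sqrt hu.le]
      field_simp
      rw [mul_sub, Real.mul_self_sqrt hu.le]
    rw [h3] at h2
    have h4 := Real.mul_self_sqrt hu.le
    have h5 := Real.mul_self_sqrt hx.le
    nlinarith

theorem sq_sqrt_sub_le_relDiv {n : ℕ} {ε : ℝ} (hε : 0 ≤ ε) {u x : Vec n} (hu : u ∈ orthant n)
    (hx : ∀ i, 0 < x i) (i : Fin n) : (√(u i) - √(x i)) ^ 2 ≤ relDiv ε u x := by
  have h : ∀ j, (√(u j) - √(x j)) ^ 2 ≤
      u j * Real.log (u j) - u j * Real.log (x j) - u j + x j + ε / 2 * (u j - x j) ^ 2 := by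
    intro j
    have := sq_sqrt_sub_le (hu j) (hx j)
    have : 0 ≤ ε / 2 * (u j - x j) ^ 2 := by positivity
    linarith
  exact (h i).trans (Finset.single_le_sum (f := fun j => u j * Real.log (u j)
    - u j * Real.log (x j) - u j + x j + ε / 2 * (u j - x j) ^ 2)
    (fun j _ => (sq_nonneg _).trans (h j)) (Finset.mem_univ i))

theorem relDiv_nonneg {n : ℕ} {ε : ℝ} (hε : 0 ≤ ε) {u x : Vec n} (hu : u ∈ orthant n)
    (hx : ∀ i, 0 < x i) : 0 ≤ relDiv ε u x := by
  refine Finset.sum_nonneg fun j _ => ?_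
  have := (sq_nonneg _).trans (sq_sqrt_sub_le (hu j) (hx j))
  positivity

theorem relDiv_pos {n : ℕ} {ε : ℝ} (hε : 0 ≤ ε) {u x : Vec n} (hu : u ∈ orthant n)
    (hx : ∀ i, 0 < x i) (hne : u ≠ x) : 0 < relDiv ε u x := by
  obtain ⟨i, hi⟩ : ∃ i, u i ≠ x i := by
    by_contra! h
    exact hne (PiLp.ext h)
  refine lt_of_lt_of_le (sq_pos_of_ne_zero ?_) (sq_sqrt_sub_le_relDiv hε hu hx i)
  rw [sub_ne_zero]
  exact fun h => hi ((Real.sqrt_inj (hu i) (hx i).le).1 h)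

theorem strictConvexOn_relFun {n : ℕ} {ε : ℝ} (hε : 0 ≤ ε) :
    StrictConvexOn ℝ (orthant n) (relFun ε : Vec n → ℝ) := by
  refine ⟨convex_orthant n, fun x hx y hy hxy a c ha hc hac => ?_⟩
  rw [relFun_eq_sum, relFun_eq_sum, relFun_eq_sum, smul_eq_mul, smul_eq_mul, Finset.mul_sum,
    Finset.mul_sum, ← Finset.sum_add_distrib]
  obtain ⟨i, hi⟩ : ∃ i, x i ≠ y i := by
    by_contra! h
    exact hxy (PiLp.ext h)
  have hsq : ∀ s t : ℝ, ε / 2 * (a * s + c * t) ^ 2 ≤ a * (ε / 2 * s ^ 2) + c * (ε / 2 * t ^ 2) := by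
    intro s t
    have h1 : a * (ε / 2 * s ^ 2) + c * (ε / 2 * t ^ 2) - ε / 2 * (a * s + c * t) ^ 2
        = ε / 2 * (a * c * (s - t) ^ 2) := by
      obtain rfl : c = 1 - a := by linarith
      ring
    have : 0 ≤ ε / 2 * (a * c * (s - t) ^ 2) := by positivity
    linarith
  refine Finset.sum_lt_sum (fun j _ => ?_) ⟨i, Finset.mem_univ i, ?_⟩
  · have h1 := Real.strictConvexOn_mul_log.convexOn.2 (hx j) (hy j) ha.le hc.le hac
    have h2 := hsq (x j) (y j)
    simp only [PiLp.add_apply, PiLp.smul_apply, smul_eq_mul] at h1 ⊢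
    linarith
  · have h1 := Real.strictConvexOn_mul_log.2 (hx i) (hy i) hi ha hc hac
    have h2 := hsq (x i) (y i)
    simp only [PiLp.add_apply, PiLp.smul_apply, smul_eq_mul] at h1 ⊢
    linarith

/-- Substituting `t = exp s` makes the equation continuous on all of `ℝ`, so the intermediate value
theorem applies. The root `-c - 1` of the case `ε = 0` is the upper endpoint. -/
theorem exists_log_add_mul_eq {ε : ℝ} (hε : 0 ≤ ε) (c : ℝ) :
    ∃ t : ℝ, 0 < t ∧ Real.log t + 1 + ε * t + c = 0 := by
  have hcont : Continuous fun s : ℝ => s + 1 + ε * Real.exp s + c := by fun_prop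
  have h0 : 0 ≤ -c - 1 + 1 + ε * Real.exp (-c - 1) + c := by
    have : 0 ≤ ε * Real.exp (-c - 1) := by positivity
    linarith
  set s₀ := -c - 1 - ε * Real.exp (-c - 1) with hs
  have hle : s₀ ≤ -c - 1 := by
    have : 0 ≤ ε * Real.exp (-c - 1) := by positivity
    linarith
  have h1 : s₀ + 1 + ε * Real.exp s₀ + c ≤ 0 := by
    have := mul_le_mul_of_nonneg_left (Real.exp_le_exp.2 hle) hε
    linarith
  obtain ⟨s, -, h⟩ := intermediate_value_Icc hle hcont.continuousOn ⟨h1, h0⟩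
  exact ⟨Real.exp s, Real.exp_pos s, by simpa using h⟩

theorem exists_relGrad_eq {n : ℕ} {ε : ℝ} (hε : 0 ≤ ε) (c : Vec n) :
    ∃ x : Vec n, (∀ i, 0 < x i) ∧ relGrad ε x = c := by
  choose t ht h using fun i => exists_log_add_mul_eq hε (-(c i))
  refine ⟨WithLp.toLp 2 t, ht, PiLp.ext fun i => ?_⟩
  have := h i
  simp only [relGrad_apply]
  linarith

/-- A point at which `relFun ε - ⟪c, ·⟫` has a vanishing gradient is its minimizer, with growth
given by the Bregman distance. -/
theorem relFun_sub_inner_eq {n : ℕ} (ε : ℝ) {c x : Vec n} (h : relGrad ε x = c) (w : Vec n) :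
    relFun ε w - inner ℝ c w = relFun ε x - inner ℝ c x + relDiv ε w x := by
  rw [relFun_eq_add_relDiv ε w x, h, inner_sub_right]
  ring

theorem isCompact_box {n : ℕ} (r : Fin n → ℝ) :
    IsCompact {x : Vec n | ∀ i, x i ∈ Set.Icc 0 (r i)} := by
  have h := (isCompact_univ_pi fun i => isCompact_Icc (a := (0 : ℝ)) (b := r i)).image
    (PiLp.continuous_toLp 2 fun _ : Fin n => ℝ)
  convert h using 1
  ext x
  constructor
  · intro hx
    exact ⟨x.ofLp, fun i _ => hx i, rfl⟩
  · rintro ⟨y, hy, rfl⟩ i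
    exact hy i (Set.mem_univ i)

theorem le_sq_of_sq_sqrt_sub_le {s t C : ℝ} (hs : 0 ≤ s) (h : (√s - √t) ^ 2 ≤ C) :
    s ≤ (√t + √C) ^ 2 := by
  have h1 : √s - √t ≤ √C := Real.le_sqrt_of_sq_le h
  rw [← Real.sq_sqrt hs]
  exact pow_le_pow_left₀ (Real.sqrt_nonneg _) (by linarith) 2

/-! ### The energy -/

theorem linOp_apply {m n : ℕ} (A : Matrix (Fin m) (Fin n) ℝ) (x : Vec n) (i : Fin m) :
    linOp A x i = ∑ j, A i j * x j := by
  simp [linOp, Matrix.toLpLin_apply, Matrix.mulVec, dotProduct]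

theorem linOp_mem_orthant {m n : ℕ} {A : Matrix (Fin m) (Fin n) ℝ} (hA : ∀ i j, 0 ≤ A i j)
    {x : Vec n} (hx : x ∈ orthant n) : linOp A x ∈ orthant m := by
  intro i
  rw [linOp_apply]
  exact Finset.sum_nonneg fun j _ => mul_nonneg (hA i j) (hx j)

/-- A zero row would keep the basis vector `eᵢ` out of the range. Consequently `A` maps positive
vectors to positive vectors, where `E` is differentiable. -/
theorem exists_entry_pos {m n : ℕ} {A : Matrix (Fin m) (Fin n) ℝ} (hA : ∀ i j, 0 ≤ A i j)
    (hsurj : Function.Surjective (linOp A)) (i : Fin m) : ∃ j, 0 < A i j := by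
  by_contra! h
  obtain ⟨x, hx⟩ := hsurj (EuclideanSpace.single i 1)
  have h1 : linOp A x i = 0 := by
    rw [linOp_apply]
    exact Finset.sum_eq_zero fun j _ => by rw [le_antisymm (h j) (hA i j), zero_mul]
  rw [hx] at h1
  simp at h1

theorem linOp_pos {m n : ℕ} {A : Matrix (Fin m) (Fin n) ℝ} (hA : ∀ i j, 0 ≤ A i j)
    (hsurj : Function.Surjective (linOp A)) {x : Vec n} (hx : ∀ j, 0 < x j) (i : Fin m) :
    0 < linOp A x i := by
  obtain ⟨j, hj⟩ := exists_entry_pos hA hsurj i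
  rw [linOp_apply]
  exact Finset.sum_pos' (fun j _ => mul_nonneg (hA i j) (hx j).le)
    ⟨j, Finset.mem_univ j, mul_pos hj (hx j)⟩

theorem energy_eq_relDiv {m n : ℕ} (A : Matrix (Fin m) (Fin n) ℝ) {b : Vec m} (ε : ℝ)
    (hb : ∀ i, 0 < b i) (x : Vec n) : energy A b ε x = relDiv ε (linOp A x) b := by
  have h0 : (entropy : Vec m → ℝ) = relFun 0 := by
    funext y; simp [relFun]
  rw [energy, h0, bregman_relFun 0 _ hb, EuclideanSpace.real_norm_sq_eq, relDiv, relDiv,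
    Finset.mul_sum, ← Finset.sum_add_distrib]
  refine Finset.sum_congr rfl fun i _ => ?_
  simp only [PiLp.sub_apply]
  ring

theorem energy_eq {m n : ℕ} (A : Matrix (Fin m) (Fin n) ℝ) {b : Vec m} (ε : ℝ)
    (hb : ∀ i, 0 < b i) (x : Vec n) :
    energy A b ε x = relFun ε (linOp A x) - inner ℝ (relGrad ε b) (linOp A x)
      - (relFun ε b - inner ℝ (relGrad ε b) b) := by
  rw [energy_eq_relDiv A ε hb, relFun_eq_add_relDiv ε (linOp A x) b, inner_sub_right]
  ring

theorem continuous_energy {m n : ℕ} (A : Matrix (Fin m) (Fin n) ℝ) {b : Vec m} (ε : ℝ)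
    (hb : ∀ i, 0 < b i) : Continuous (energy A b ε) := by
  rw [funext (energy_eq A ε hb)]
  have := (continuous_relFun (n := m) ε).comp (linOp A).continuous
  exact (this.sub (continuous_const.inner (linOp A).continuous)).sub continuous_const

/-- The gradient of the energy at points with positive coordinates. -/
def energyGrad {m n : ℕ} (A : Matrix (Fin m) (Fin n) ℝ) (b : Vec m) (ε : ℝ) (x : Vec n) : Vec n :=
  ContinuousLinearMap.adjoint (linOp A) (relGrad ε (linOp A x) - relGrad ε b)

theorem hasGradientAt_energy {m n : ℕ} {A : Matrix (Fin m) (Fin n) ℝ} {b : Vec m} (ε : ℝ)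
    (hb : ∀ i, 0 < b i) {x : Vec n} (hx : ∀ i, 0 < linOp A x i) :
    HasGradientAt (energy A b ε) (energyGrad A b ε x) x := by
  rw [hasGradientAt_iff_hasFDerivAt, funext (energy_eq A ε hb)]
  have h1 := (hasGradientAt_iff_hasFDerivAt.1 (hasGradientAt_relFun ε hx)).comp x
    (linOp A).hasFDerivAt
  have h2 := ((toDual ℝ (Vec m) (relGrad ε b)).comp (linOp A)).hasFDerivAt (x := x)
  refine ((h1.sub h2).sub_const _).congr_fderiv ?_
  ext v
  simp [energyGrad, toDual_apply_apply, ContinuousLinearMap.adjoint_inner_left]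

theorem energy_eq_add {m n : ℕ} (A : Matrix (Fin m) (Fin n) ℝ) {b : Vec m} (ε : ℝ)
    (hb : ∀ i, 0 < b i) (u x : Vec n) :
    energy A b ε u = energy A b ε x + inner ℝ (energyGrad A b ε x) (u - x)
      + relDiv ε (linOp A u) (linOp A x) := by
  rw [energy_eq A ε hb, energy_eq A ε hb, energyGrad, ContinuousLinearMap.adjoint_inner_left,
    relFun_eq_add_relDiv ε (linOp A u) (linOp A x), map_sub, inner_sub_left, inner_sub_right,
    inner_sub_right]
  ring

theorem energy_add_inner_le {m n : ℕ} {A : Matrix (Fin m) (Fin n) ℝ} {b : Vec m} {ε : ℝ}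
    (hε : 0 ≤ ε) (hA : ∀ i j, 0 ≤ A i j) (hsurj : Function.Surjective (linOp A))
    (hb : ∀ i, 0 < b i) {u x : Vec n} (hu : u ∈ orthant n) (hx : ∀ i, 0 < x i) :
    energy A b ε x + inner ℝ (energyGrad A b ε x) (u - x) ≤ energy A b ε u := by
  rw [energy_eq_add A ε hb u x]
  have := relDiv_nonneg hε (linOp_mem_orthant hA hu) (linOp_pos hA hsurj hx)
  linarith

/-- The subgradient inequality for a convex function at a point of differentiability. -/
theorem _root_.ConvexOn.add_inner_le {E : Type*} [NormedAddCommGroup E] [InnerProductSpace ℝ E]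
    [CompleteSpace E] {s : Set E} {f : E → ℝ} {g x y : E} (hf : ConvexOn ℝ s f) (hx : x ∈ s)
    (hy : y ∈ s) (hg : HasGradientAt f g x) : f x + inner ℝ g (y - x) ≤ f y := by
  have h1 : ConvexOn ℝ (AffineMap.lineMap x y ⁻¹' s) (f ∘ AffineMap.lineMap (k := ℝ) x y) :=
    hf.comp_affineMap _
  have hd : HasDerivAt (AffineMap.lineMap (k := ℝ) x y) (y - x) (0 : ℝ) :=
    AffineMap.hasDerivAt_lineMap
  have hg' : HasFDerivAt f (toDual ℝ E g) (AffineMap.lineMap x y (0 : ℝ)) := by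
    simpa using hasGradientAt_iff_hasFDerivAt.1 hg
  have h2 := h1.le_slope_of_hasDerivAt (x := 0) (y := 1) (by simpa using hx) (by simpa using hy)
    zero_lt_one (hg'.comp_hasDerivAt 0 hd)
  simp [slope_def_field, toDual_apply_apply] at h2
  linarith

/-- The descent lemma of the Bregman geometry. -/
theorem LipschitzLike.energy_le {m n : ℕ} {A : Matrix (Fin m) (Fin n) ℝ} {b : Vec m} {ε L : ℝ}
    (hA : ∀ i j, 0 ≤ A i j) (hsurj : Function.Surjective (linOp A)) (hb : ∀ i, 0 < b i)
    (h : LipschitzLike A b ε L) {x y : Vec n} (hx : ∀ i, 0 < x i) (hy : ∀ i, 0 < y i) :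
    energy A b ε y ≤ energy A b ε x + inner ℝ (energyGrad A b ε x) (y - x)
      + L * relDiv ε y x := by
  have hg : HasGradientAt (fun x => L * relFun ε x - energy A b ε x)
      (L • relGrad ε x - energyGrad A b ε x) x := by
    rw [hasGradientAt_iff_hasFDerivAt, map_sub, map_smul]
    exact ((hasGradientAt_iff_hasFDerivAt.1 (hasGradientAt_relFun ε hx)).const_mul L).sub
      (hasGradientAt_iff_hasFDerivAt.1 (hasGradientAt_energy ε hb (linOp_pos hA hsurj hx)))
  have h1 := ConvexOn.add_inner_le h (mem_interior_orthant.2 hx) (mem_interior_orthant.2 hy) hg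
  rw [inner_sub_left, real_inner_smul_left] at h1
  have h2 := relFun_eq_add_relDiv ε y x
  simp only [h2] at h1
  linarith

/-! ### The Lipschitz-like convexity condition -/

/-- Bound each term by its tangent at the common ratio `r = (u + v)/(s + t)`; on adding, the linear
corrections `u + v` and `r(s + t)` cancel. -/
theorem log_sum_inequality {u v s t : ℝ} (hu : 0 < u) (hv : 0 < v) (hs : 0 < s) (ht : 0 < t) :
    (u + v) * (Real.log (u + v) - Real.log (s + t))
      ≤ u * (Real.log u - Real.log s) + v * (Real.log v - Real.log t) := by
  have key : ∀ {u s : ℝ}, 0 < u → 0 < s → ∀ {r : ℝ}, 0 < r →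
      u * Real.log r + u - r * s ≤ u * (Real.log u - Real.log s) := by
    intro u s hu hs r hr
    have h := Real.log_le_sub_one_of_pos (div_pos (mul_pos hr hs) hu)
    rw [Real.log_div (mul_pos hr hs).ne' hu.ne', Real.log_mul hr.ne' hs.ne'] at h
    have h2 := mul_le_mul_of_nonneg_left h hu.le
    rw [mul_sub _ (_ / _), mul_div_cancel₀ _ hu.ne'] at h2
    linarith
  have hr : 0 < (u + v) / (s + t) := by positivity
  have h1 := key hu hs hr
  have h2 := key hv ht hr
  have h3 : (u + v) / (s + t) * s + (u + v) / (s + t) * t = u + v := by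
    have : s + t ≠ 0 := by positivity
    field_simp
  rw [Real.log_div (by positivity) (by positivity)] at h1 h2
  linarith

theorem convex_interior_orthant (n : ℕ) : Convex ℝ (interior (orthant n)) :=
  (convex_orthant n).interior

/-- The difference `∑ⱼ aⱼ xⱼ log xⱼ - s log s` with `s = ∑ⱼ aⱼ xⱼ` is convex. -/
theorem convexOn_sum_mul_log_sub {n : ℕ} {a : Fin n → ℝ} (ha : ∀ j, 0 ≤ a j)
    (hpos : ∃ j, 0 < a j) :
    ConvexOn ℝ (interior (orthant n)) (fun x : Vec n => ∑ j, a j * (x j * Real.log (x j))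
      - (∑ j, a j * x j) * Real.log (∑ j, a j * x j)) := by
  have hS : ∀ x : Vec n, x ∈ interior (orthant n) → 0 < ∑ j, a j * x j := by
    intro x hx
    obtain ⟨j, hj⟩ := hpos
    exact Finset.sum_pos' (fun j _ => mul_nonneg (ha j) (mem_interior_orthant.1 hx j).le)
      ⟨j, Finset.mem_univ j, mul_pos hj (mem_interior_orthant.1 hx j)⟩
  -- As `∑ aⱼ xⱼ log (xⱼ / s)`, each summand is a relative entropy, jointly convex in `(xⱼ, s)`, and
  -- `s` is linear in `x`.
  have hrw : ∀ x : Vec n, ∑ j, a j * (x j * Real.log (x j))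
      - (∑ j, a j * x j) * Real.log (∑ j, a j * x j)
      = ∑ j, a j * (x j * (Real.log (x j) - Real.log (∑ j, a j * x j))) := by
    intro x
    rw [Finset.sum_mul, ← Finset.sum_sub_distrib]
    exact Finset.sum_congr rfl fun j _ => by ring
  simp only [hrw]
  rw [convexOn_iff_forall_pos]
  refine ⟨convex_interior_orthant n, fun x hx y hy p q hp hq _ => ?_⟩
  rw [smul_eq_mul, smul_eq_mul, Finset.mul_sum, Finset.mul_sum, ← Finset.sum_add_distrib]
  refine Finset.sum_le_sum fun j _ => ?_
  have hsum : ∑ j, a j * (p • x + q • y) j = p * ∑ j, a j * x j + q * ∑ j, a j * y j := by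
    rw [Finset.mul_sum, Finset.mul_sum, ← Finset.sum_add_distrib]
    refine Finset.sum_congr rfl fun j _ => ?_
    simp only [PiLp.add_apply, PiLp.smul_apply, smul_eq_mul]
    ring
  rw [hsum]
  have hxj := mem_interior_orthant.1 hx j
  have hyj := mem_interior_orthant.1 hy j
  have h := log_sum_inequality (mul_pos hp hxj) (mul_pos hq hyj) (mul_pos hp (hS x hx))
    (mul_pos hq (hS y hy))
  rw [Real.log_mul hp.ne' hxj.ne', Real.log_mul hq.ne' hyj.ne', Real.log_mul hp.ne' (hS x hx).ne',
    Real.log_mul hq.ne' (hS y hy).ne'] at h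
  have h2 := mul_le_mul_of_nonneg_left h (ha j)
  simp only [PiLp.add_apply, PiLp.smul_apply, smul_eq_mul]
  refine h2.trans (le_of_eq ?_)
  ring

/-- A quadratic form is convex once it is nonnegative: its convexity gap at weights `p, q` is `pq`
times its value at `x - y`. -/
theorem convexOn_sub_norm_sq {m n : ℕ} (T : Vec n →L[ℝ] Vec m) {L : ℝ} (hL : ‖T‖ ^ 2 ≤ L) :
    ConvexOn ℝ (Set.univ : Set (Vec n)) (fun x => L * ‖x‖ ^ 2 - ‖T x‖ ^ 2) := by
  have hT : ∀ v, 0 ≤ L * ‖v‖ ^ 2 - ‖T v‖ ^ 2 := by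
    intro v
    have h1 := pow_le_pow_left₀ (norm_nonneg _) (T.le_opNorm v) 2
    rw [mul_pow] at h1
    have := mul_le_mul_of_nonneg_right hL (sq_nonneg ‖v‖)
    linarith
  refine ⟨convex_univ, fun x _ y _ p q hp hq hpq => ?_⟩
  have key : ∀ {k : ℕ} (u v : Vec k), ‖p • u + q • v‖ ^ 2
      = p * ‖u‖ ^ 2 + q * ‖v‖ ^ 2 - p * q * ‖u - v‖ ^ 2 := by
    intro k u v
    rw [norm_add_sq_real, norm_sub_sq_real, norm_smul, norm_smul, real_inner_smul_left,
      real_inner_smul_right, mul_pow, mul_pow, Real.norm_eq_abs, Real.norm_eq_abs, sq_abs, sq_abs]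
    obtain rfl : q = 1 - p := by linarith
    ring
  have h := mul_nonneg (mul_nonneg hp hq) (hT (x - y))
  simp only [map_add, map_smul, smul_eq_mul, key]
  rw [map_sub] at h
  linarith

/-- `Lh - E` splits into four convex pieces: the log-sum differences of the rows of `A`, the
leftover entropy with weights `L - ∑ᵢ aᵢⱼ ≥ 0`, the quadratic part controlled by the spectral norm,
and an affine term. -/
theorem lipschitzLike_of_le {m n : ℕ} {A : Matrix (Fin m) (Fin n) ℝ} {b : Vec m} {ε L : ℝ}
    (hε : 0 ≤ ε) (hA : ∀ i j, 0 ≤ A i j) (hsurj : Function.Surjective (linOp A))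
    (hb : ∀ i, 0 < b i) (hL : ‖linOp A‖ ^ 2 ≤ L) (hcol : ∀ j, ∑ i, A i j ≤ L) :
    LipschitzLike A b ε L := by
  have hcv := convex_interior_orthant n
  have h1 : ConvexOn ℝ (interior (orthant n)) (fun x : Vec n =>
      ∑ i, (∑ j, A i j * (x j * Real.log (x j))
        - (∑ j, A i j * x j) * Real.log (∑ j, A i j * x j))) := by
    have h := Finset.sum_induction (s := Finset.univ)
      (fun i => fun x : Vec n => ∑ j, A i j * (x j * Real.log (x j))
        - (∑ j, A i j * x j) * Real.log (∑ j, A i j * x j))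
      (ConvexOn ℝ (interior (orthant n))) (fun f g hf hg => hf.add hg) (convexOn_const 0 hcv)
      (fun i _ => convexOn_sum_mul_log_sub (hA i) (exists_entry_pos hA hsurj i))
    exact h.congr fun x _ => by simp
  have h2 : ConvexOn ℝ (interior (orthant n)) (fun x : Vec n =>
      ∑ j, (L - ∑ i, A i j) * (x j * Real.log (x j))) := by
    refine ⟨hcv, fun x hx y hy p q hp hq hpq => ?_⟩
    rw [smul_eq_mul, smul_eq_mul, Finset.mul_sum, Finset.mul_sum, ← Finset.sum_add_distrib]
    refine Finset.sum_le_sum fun j _ => ?_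
    have h := Real.strictConvexOn_mul_log.convexOn.2 (mem_interior_orthant.1 hx j).le
      (mem_interior_orthant.1 hy j).le hp hq hpq
    have := mul_le_mul_of_nonneg_left h (sub_nonneg.2 (hcol j))
    simp only [PiLp.add_apply, PiLp.smul_apply, smul_eq_mul] at this ⊢
    linarith
  have h3 := ((convexOn_sub_norm_sq (linOp A) hL).subset (Set.subset_univ _) hcv).smul
    (div_nonneg hε zero_le_two)
  have h4 : ConvexOn ℝ (interior (orthant n)) (fun x : Vec n =>
      inner ℝ (relGrad ε b) (linOp A x) + (relFun ε b - inner ℝ (relGrad ε b) b)) :=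
    ((((toDual ℝ (Vec m) (relGrad ε b)).comp (linOp A)).toLinearMap.convexOn hcv).add
      (convexOn_const _ hcv))
  have h := ((h1.add h2).add h3).add h4
  refine h.congr fun x _ => ?_
  simp only [Pi.add_apply, smul_eq_mul]
  have e0 : entropy (linOp A x)
      = ∑ i, (∑ j, A i j * x j) * Real.log (∑ j, A i j * x j) := by
    simp only [entropy, linOp_apply]
  rw [energy_eq A ε hb,
    show relFun ε x = ∑ j, x j * Real.log (x j) + ε / 2 * ‖x‖ ^ 2 from rfl,
    show relFun ε (linOp A x) = entropy (linOp A x) + ε / 2 * ‖linOp A x‖ ^ 2 from rfl,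
    e0, Finset.sum_sub_distrib, Finset.sum_comm]
  have e1 : ∑ j, (L - ∑ i, A i j) * (x j * Real.log (x j))
      = L * ∑ j, x j * Real.log (x j) - ∑ j, ∑ i, A i j * (x j * Real.log (x j)) := by
    rw [Finset.mul_sum, ← Finset.sum_sub_distrib]
    refine Finset.sum_congr rfl fun j _ => ?_
    rw [sub_mul, Finset.sum_mul]
  rw [e1]
  ring

/-! ### The minimizers of the energy -/

theorem mem_X0_iff {m n : ℕ} {A : Matrix (Fin m) (Fin n) ℝ} {b : Vec m} {ε : ℝ} {x : Vec n} :
    x ∈ X0 A b ε ↔ x ∈ orthant n ∧ ∀ z ∈ orthant n, energy A b ε x ≤ energy A b ε z := by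
  rw [X0, closure_orthant, Set.mem_ofPred_eq]

theorem X0_nonempty {m n : ℕ} {A : Matrix (Fin m) (Fin n) ℝ} {b : Vec m} {ε : ℝ}
    (hε : 0 ≤ ε) (hA : ∀ i j, 0 ≤ A i j) (hb : ∀ i, 0 < b i) : (X0 A b ε).Nonempty := by
  set C := energy A b ε 0 with hC
  set R : Fin m → ℝ := fun i => (√(b i) + √C) ^ 2
  have hR : ∀ i, 0 ≤ R i := fun i => sq_nonneg _
  -- Terms with `A i j = 0` contribute `0`; the bound is used only through an entry `A i j > 0`,
  -- where `A i j * x j ≤ R i`.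
  set r : Fin n → ℝ := fun j => ∑ i, R i / A i j
  have hr : ∀ i j, R i / A i j ≤ r j := fun i j =>
    Finset.single_le_sum (f := fun i => R i / A i j)
      (fun i _ => div_nonneg (hR i) (hA i j)) (Finset.mem_univ i)
  have hr0 : ∀ j, 0 ≤ r j := fun j => Finset.sum_nonneg fun i _ => div_nonneg (hR i) (hA i j)
  have h0 : (0 : Vec n) ∈ {x : Vec n | ∀ j, x j ∈ Set.Icc 0 (r j)} := fun j => ⟨le_rfl, hr0 j⟩
  obtain ⟨z, hz, hmin⟩ := (isCompact_box r).exists_isMinOn ⟨0, h0⟩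
    (continuous_energy A ε hb).continuousOn
  refine ⟨z, mem_X0_iff.2 ⟨fun j => (hz j).1, fun x hx => ?_⟩⟩
  by_cases hxC : energy A b ε x ≤ C
  · classical
    -- Zero columns of `A` destroy coercivity, but the energy ignores those coordinates; setting
    -- them to `0` brings the point into the box.
    set y : Vec n := WithLp.toLp 2 fun j => if ∃ i, 0 < A i j then x j else 0 with hy
    have hAy : linOp A y = linOp A x := by
      refine PiLp.ext fun i => ?_
      rw [linOp_apply, linOp_apply]
      refine Finset.sum_congr rfl fun j _ => ?_
      by_cases hj : ∃ i, 0 < A i j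
      · simp only [hy, if_pos hj]
      · push Not at hj
        rw [le_antisymm (hj i) (hA i j), zero_mul, zero_mul]
    have hyE : energy A b ε y = energy A b ε x := by
      rw [energy_eq_relDiv A ε hb, energy_eq_relDiv A ε hb, hAy]
    rw [← hyE]
    refine hmin (a := y) fun j => ?_
    by_cases hj : ∃ i, 0 < A i j
    · have hyj : y j = x j := by simp only [hy, if_pos hj]
      rw [hyj]
      refine ⟨hx j, ?_⟩
      obtain ⟨i, hi⟩ := hj
      refine le_trans ?_ (hr i j)
      rw [le_div_iff₀ hi]
      have h1 : linOp A x i ≤ R i := by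
        refine le_sq_of_sq_sqrt_sub_le (linOp_mem_orthant hA hx i) ?_
        refine (sq_sqrt_sub_le_relDiv hε (linOp_mem_orthant hA hx) hb i).trans ?_
        rwa [← energy_eq_relDiv A ε hb]
      refine le_trans ?_ h1
      rw [linOp_apply, mul_comm]
      exact Finset.single_le_sum (f := fun j => A i j * x j)
        (fun j _ => mul_nonneg (hA i j) (hx j)) (Finset.mem_univ j)
    · have hyj : y j = 0 := by simp only [hy, if_neg hj]
      rw [hyj]
      exact ⟨le_rfl, hr0 j⟩
  · exact (hmin h0).trans (not_le.1 hxC).le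

theorem midpoint_mem_orthant {n : ℕ} {x y : Vec n} (hx : x ∈ orthant n) (hy : y ∈ orthant n) :
    (1 / 2 : ℝ) • x + (1 / 2 : ℝ) • y ∈ orthant n :=
  convex_orthant n hx hy (by norm_num) (by norm_num) (by norm_num)

/-- `E` is a strictly convex function of `Ax`, so two minimizers with different images would be
beaten by their midpoint. -/
theorem linOp_eq_of_mem_X0 {m n : ℕ} {A : Matrix (Fin m) (Fin n) ℝ} {b : Vec m} {ε : ℝ}
    (hε : 0 ≤ ε) (hA : ∀ i j, 0 ≤ A i j) (hb : ∀ i, 0 < b i) {x y : Vec n}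
    (hx : x ∈ X0 A b ε) (hy : y ∈ X0 A b ε) : linOp A x = linOp A y := by
  rw [mem_X0_iff] at hx hy
  by_contra hne
  have h := (strictConvexOn_relFun hε).2 (linOp_mem_orthant hA hx.1) (linOp_mem_orthant hA hy.1)
    hne (one_half_pos (α := ℝ)) (one_half_pos (α := ℝ)) (by norm_num)
  have h1 := hx.2 _ (midpoint_mem_orthant hx.1 hy.1)
  have h2 := hy.2 _ (midpoint_mem_orthant hx.1 hy.1)
  simp only [energy_eq A ε hb, map_add, map_smul, inner_add_right, real_inner_smul_right] at h1 h2
  simp only [smul_eq_mul] at h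
  linarith

theorem mem_X0_of_linOp_eq {m n : ℕ} {A : Matrix (Fin m) (Fin n) ℝ} {b : Vec m} {ε : ℝ}
    (hb : ∀ i, 0 < b i) {x y : Vec n} (hx : x ∈ X0 A b ε) (hy : y ∈ orthant n)
    (h : linOp A y = linOp A x) : y ∈ X0 A b ε := by
  rw [mem_X0_iff] at hx ⊢
  refine ⟨hy, fun z hz => ?_⟩
  have : energy A b ε y = energy A b ε x := by
    rw [energy_eq_relDiv A ε hb, energy_eq_relDiv A ε hb, h]
  rw [this]
  exact hx.2 z hz

theorem isClosed_X0 {m n : ℕ} (A : Matrix (Fin m) (Fin n) ℝ) {b : Vec m} (ε : ℝ)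
    (hb : ∀ i, 0 < b i) : IsClosed (X0 A b ε) := by
  have : X0 A b ε = orthant n ∩ ⋂ z ∈ orthant n, {x | energy A b ε x ≤ energy A b ε z} := by
    ext x
    simp [mem_X0_iff]
  rw [this]
  exact (isClosed_orthant n).inter (isClosed_biInter fun z _ =>
    isClosed_le (continuous_energy A ε hb) continuous_const)

/-! ### The regularized problem -/

theorem l1_eq_inner {n : ℕ} {x : Vec n} (hx : x ∈ orthant n) :
    l1 x = inner ℝ (WithLp.toLp 2 fun _ => 1 : Vec n) x := by
  rw [inner_eq_sum, l1]
  exact Finset.sum_congr rfl fun i _ => by simp [abs_of_nonneg (hx i)]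

theorem mul_regObj {n : ℕ} (ε μ : ℝ) {δ : ℝ} (hδ : 0 < δ) {x : Vec n} (hx : x ∈ orthant n) :
    δ * regObj ε μ δ x
      = relFun ε x - inner ℝ (-(δ * μ) • (WithLp.toLp 2 fun _ => 1 : Vec n)) x := by
  rw [regObj, relFun, l1_eq_inner hx, real_inner_smul_left]
  field_simp
  ring

theorem subObj_eq {n : ℕ} (ε μ δ : ℝ) (q : Vec n) {x : Vec n} (hx : x ∈ orthant n) :
    subObj ε μ δ q x
      = relFun ε x - inner ℝ (-q - (δ * μ) • (WithLp.toLp 2 fun _ => 1 : Vec n)) x := by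
  rw [subObj, relFun, l1_eq_inner hx, inner_sub_left, inner_neg_left, real_inner_smul_left]
  ring

theorem exists_subObj_minimizer {n : ℕ} {ε : ℝ} (μ δ : ℝ) (hε : 0 ≤ ε) (q : Vec n) :
    ∃ z : Vec n, (∀ i, 0 < z i) ∧
      relGrad ε z = -q - (δ * μ) • (WithLp.toLp 2 fun _ => 1 : Vec n) ∧
      ∀ w ∈ orthant n, w ≠ z → subObj ε μ δ q z < subObj ε μ δ q w := by
  obtain ⟨z, hz, h⟩ := exists_relGrad_eq hε (-q - (δ * μ) • (WithLp.toLp 2 fun _ => 1 : Vec n))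
  refine ⟨z, hz, h, fun w hw hne => ?_⟩
  rw [subObj_eq ε μ δ q hw, subObj_eq ε μ δ q (mem_orthant_of_pos hz), relFun_sub_inner_eq ε h w]
  have := relDiv_pos hε hw hz hne
  linarith

/-- On the orthant, `δ` times the objective is `h` minus a linear form. Its unconstrained minimizer
`y` puts the sublevel set of any `z₀ ∈ X0` in a box, giving existence; strict convexity along
midpoints, which stay in `X0`, gives uniqueness. -/
theorem exists_regObj_minimizer {m n : ℕ} {A : Matrix (Fin m) (Fin n) ℝ} {b : Vec m} {ε δ : ℝ}
    (μ : ℝ) (hε : 0 ≤ ε) (hδ : 0 < δ) (hA : ∀ i j, 0 ≤ A i j) (hb : ∀ i, 0 < b i) :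
    ∃ xhat ∈ X0 A b ε, ∀ z ∈ X0 A b ε, z ≠ xhat → regObj ε μ δ xhat < regObj ε μ δ z := by
  set c : Vec n := -(δ * μ) • (WithLp.toLp 2 fun _ => 1 : Vec n) with hc
  set f : Vec n → ℝ := fun x => relFun ε x - inner ℝ c x with hf
  have hfc : Continuous f := (continuous_relFun ε).sub (continuous_const.inner continuous_id)
  obtain ⟨y, hy, hyc⟩ := exists_relGrad_eq hε c
  obtain ⟨z₀, hz₀⟩ := X0_nonempty (A := A) (n := n) hε hA hb
  set C := f z₀ - f y with hC
  set r : Fin n → ℝ := fun i => (√(y i) + √C) ^ 2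
  have hbox : ∀ z ∈ X0 A b ε, f z ≤ f z₀ → z ∈ {x : Vec n | ∀ i, x i ∈ Set.Icc 0 (r i)} := by
    intro z hz hle i
    have hzo := (mem_X0_iff.1 hz).1
    refine ⟨hzo i, le_sq_of_sq_sqrt_sub_le (hzo i) ?_⟩
    refine (sq_sqrt_sub_le_relDiv hε hzo hy i).trans ?_
    have : f z = f y + relDiv ε z y := relFun_sub_inner_eq ε hyc z
    linarith
  obtain ⟨x, hx, hmin⟩ := ((isCompact_box r).inter_right (isClosed_X0 A ε hb)).exists_isMinOn
    ⟨z₀, hbox z₀ hz₀ le_rfl, hz₀⟩ hfc.continuousOn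
  have hfx : ∀ z ∈ X0 A b ε, f x ≤ f z := by
    intro z hz
    by_cases hle : f z ≤ f z₀
    · exact hmin ⟨hbox z hz hle, hz⟩
    · exact (hmin (a := z₀) ⟨hbox z₀ hz₀ le_rfl, hz₀⟩).trans (not_le.1 hle).le
  refine ⟨x, hx.2, fun z hz hne => ?_⟩
  have hxo := (mem_X0_iff.1 hx.2).1
  have hzo := (mem_X0_iff.1 hz).1
  have hlt : f x < f z := by
    refine lt_of_le_of_ne (hfx z hz) fun heq => ?_
    have hs := (strictConvexOn_relFun hε).2 hxo hzo (Ne.symm hne) (one_half_pos (α := ℝ))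
      (one_half_pos (α := ℝ)) (by norm_num)
    have hm : (1 / 2 : ℝ) • x + (1 / 2 : ℝ) • z ∈ X0 A b ε := by
      refine mem_X0_of_linOp_eq hb hx.2 (midpoint_mem_orthant hxo hzo) ?_
      rw [map_add, map_smul, map_smul, linOp_eq_of_mem_X0 hε hA hb hz hx.2, ← add_smul]
      norm_num
    have := hfx _ hm
    simp only [hf, inner_add_right, real_inner_smul_right, smul_eq_mul] at this heq hs
    linarith
  have h1 := mul_regObj ε μ hδ hxo
  have h2 := mul_regObj ε μ hδ hzo
  refine lt_of_mul_lt_mul_left ?_ hδ.le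
  rw [h1, h2]
  exact hlt

/-! ### The symmetry coefficient -/

/-- The entropy has no symmetry: the symmetry coefficient is attained in the limit
`x = (t, …, t)`, `y = (1, …, 1)`, `t → 0`. -/
theorem symCoeff_nonpos (n : ℕ) {ε : ℝ} (hε : 0 ≤ ε) : symCoeff n ε ≤ 0 := by
  rcases Nat.eq_zero_or_pos n with rfl | hn
  · rw [symCoeff]
    refine le_of_eq ?_
    convert Real.sInf_empty
    refine Set.eq_empty_iff_forall_notMem.2 ?_
    rintro r ⟨x, -, y, -, hne, -⟩
    exact hne (Subsingleton.elim x y)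
  by_contra! hα
  set α := symCoeff n ε with hαdef
  have hbdd : BddBelow {r | ∃ x ∈ interior (orthant n), ∃ y ∈ interior (orthant n),
      x ≠ y ∧ r = bregman (relFun ε) x y / bregman (relFun ε) y x} := by
    refine ⟨0, ?_⟩
    rintro r ⟨x, hx, y, hy, -, rfl⟩
    rw [mem_interior_orthant] at hx hy
    rw [bregman_relFun ε x hy, bregman_relFun ε y hx]
    exact div_nonneg (relDiv_nonneg hε (mem_orthant_of_pos hx) hy)
      (relDiv_nonneg hε (mem_orthant_of_pos hy) hx)
  -- Chosen so that `α (K - 1) = α + 1 + ε/2`, while the divergence of `x` from `y` stays below `1 +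
  -- ε/2` per coordinate.
  set K := 2 + (1 + ε / 2) / α with hK
  have hK0 : 0 < K := by positivity
  set t := Real.exp (-K) with ht
  have ht0 : 0 < t := Real.exp_pos _
  have ht1 : t < 1 := by simpa [ht] using hK0
  have hlog : Real.log t = -K := Real.log_exp _
  set x : Vec n := WithLp.toLp 2 fun _ => t
  set y : Vec n := WithLp.toLp 2 fun _ => 1
  have hx : ∀ i, 0 < x i := fun _ => ht0
  have hy : ∀ i, 0 < y i := fun _ => one_pos
  have hne : x ≠ y := fun h => ht1.ne (congrArg (fun z : Vec n => z ⟨0, hn⟩) h)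
  have hle : α ≤ relDiv ε x y / relDiv ε y x := by
    refine csInf_le hbdd ⟨x, mem_interior_orthant.2 hx, y, mem_interior_orthant.2 hy, hne, ?_⟩
    rw [bregman_relFun ε x hy, bregman_relFun ε y hx]
  rw [le_div_iff₀ (relDiv_pos hε (mem_orthant_of_pos hy) hx hne.symm)] at hle
  have e1 : relDiv ε x y = n * (t * -K - t + 1 + ε / 2 * (t - 1) ^ 2) := by
    simp [relDiv, x, y, hlog]
    ring
  have e2 : relDiv ε y x = n * (K - 1 + t + ε / 2 * (1 - t) ^ 2) := by
    simp [relDiv, x, y, hlog]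
    ring
  rw [e1, e2, mul_left_comm] at hle
  have h1 := le_of_mul_le_mul_left hle (Nat.cast_pos.2 hn)
  have h2 : α * (K - 1) = α + (1 + ε / 2) := by
    rw [hK]; field_simp; ring
  have h3 : (t - 1) ^ 2 ≤ 1 := by nlinarith
  have h4 := mul_le_mul_of_nonneg_left h3 (div_nonneg hε zero_le_two)
  have h5 : 0 ≤ α * (t + ε / 2 * (1 - t) ^ 2) := by positivity
  have h6 : 0 < t * K := by positivity
  nlinarith

/-! ### The mirror descent step -/

/-- Three-point identity for `h` at `u, x, y`, in which `∇h(x) - ∇h(y) = δ∇E(x)`. The resulting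
inner product is bounded by convexity of `E` towards `u` and by the descent lemma towards `y`. -/
theorem relDiv_le_of_step {m n : ℕ} {A : Matrix (Fin m) (Fin n) ℝ} {b : Vec m} {ε δ L : ℝ}
    (hε : 0 ≤ ε) (hδ : 0 < δ) (hA : ∀ i j, 0 ≤ A i j) (hsurj : Function.Surjective (linOp A))
    (hb : ∀ i, 0 < b i) (hL : LipschitzLike A b ε L) {u x y : Vec n} (hu : u ∈ orthant n)
    (hx : ∀ i, 0 < x i) (hy : ∀ i, 0 < y i)
    (h : relGrad ε y = relGrad ε x - δ • energyGrad A b ε x) :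
    relDiv ε u y ≤ relDiv ε u x - (1 - δ * L) * relDiv ε y x
      + δ * (energy A b ε u - energy A b ε y) := by
  have h1 := relFun_eq_add_relDiv ε u y
  have h2 := relFun_eq_add_relDiv ε u x
  have h3 := relFun_eq_add_relDiv ε y x
  have h4 := mul_le_mul_of_nonneg_left (energy_add_inner_le hε hA hsurj hb hu hx) hδ.le
  have h5 := mul_le_mul_of_nonneg_left (hL.energy_le hA hsurj hb hx hy) hδ.le
  rw [h] at h1
  simp only [inner_sub_left, inner_sub_right, real_inner_smul_left] at h1 h2 h3 h4 h5
  linarith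

theorem tendsto_of_tendsto_relDiv {n : ℕ} {ε : ℝ} (hε : 0 ≤ ε) {x : ℕ → Vec n} {u : Vec n}
    (hu : u ∈ orthant n) (hx : ∀ k i, 0 < x k i)
    (h : Tendsto (fun k => relDiv ε u (x k)) atTop (𝓝 0)) : Tendsto x atTop (𝓝 u) := by
  have hc : ∀ i, Tendsto (fun k => x k i) atTop (𝓝 (u i)) := by
    intro i
    have h1 : Tendsto (fun k => (√(u i) - √(x k i)) ^ 2) atTop (𝓝 0) :=
      squeeze_zero (fun k => sq_nonneg _) (fun k => sq_sqrt_sub_le_relDiv hε hu (hx k) i) h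
    have h2 : Tendsto (fun k => √(u i) - √(x k i)) atTop (𝓝 0) := by
      refine (tendsto_zero_iff_abs_tendsto_zero _).2 ?_
      have := (Real.continuous_sqrt.tendsto 0).comp h1
      simpa [Function.comp_def, Real.sqrt_sq_eq_abs] using this
    have h3 : Tendsto (fun k => (√(u i) - (√(u i) - √(x k i))) ^ 2) atTop
        (𝓝 ((√(u i) - 0) ^ 2)) := (tendsto_const_nhds.sub h2).pow 2
    simpa [Real.sq_sqrt (hu i), fun k => Real.sq_sqrt (hx k i).le] using h3
  have h1 : Tendsto (fun k => (x k).ofLp) atTop (𝓝 u.ofLp) := tendsto_pi_nhds.2 hc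
  exact ((PiLp.continuous_toLp 2 fun _ : Fin n => ℝ).tendsto u.ofLp).comp h1

theorem tendsto_relDiv_of_tendsto {n : ℕ} (ε : ℝ) {x : ℕ → Vec n} {u : Vec n}
    (h : Tendsto x atTop (𝓝 u)) : Tendsto (fun k => relDiv ε u (x k)) atTop (𝓝 0) := by
  rw [show (0 : ℝ) = ∑ i : Fin n, 0 by simp]
  refine tendsto_finsetSum _ fun i _ => ?_
  have hi : Tendsto (fun k => x k i) atTop (𝓝 (u i)) :=
    ((by fun_prop : Continuous fun y : Vec n => y i).tendsto u).comp h
  have hl : Tendsto (fun k => u i * Real.log (x k i)) atTop (𝓝 (u i * Real.log (u i))) := by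
    -- At a vanishing coordinate of `u` the logarithmic term is identically `0`, so a boundary limit
    -- `u` is allowed.
    by_cases h0 : u i = 0
    · simp [h0]
    · exact ((Real.continuousAt_log h0).tendsto.comp hi).const_mul _
  have := (((tendsto_const_nhds (x := u i * Real.log (u i))).sub hl).sub
    (tendsto_const_nhds (x := u i))).add hi |>.add
      ((((tendsto_const_nhds (x := u i)).sub hi).pow 2).const_mul (ε / 2))
  simpa using this

/-- Mirror descent with relative function `relFun` converges to a minimizer of the energy. -/
theorem exists_tendsto_of_step {m n : ℕ} {A : Matrix (Fin m) (Fin n) ℝ} {b : Vec m} {ε δ L : ℝ}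
    (hε : 0 ≤ ε) (hδ : 0 < δ) (hA : ∀ i j, 0 ≤ A i j) (hsurj : Function.Surjective (linOp A))
    (hb : ∀ i, 0 < b i) (hL : LipschitzLike A b ε L) (hδL : δ * L ≤ 1) {x : ℕ → Vec n}
    (hx : ∀ k i, 0 < x k i)
    (h : ∀ k, relGrad ε (x (k + 1)) = relGrad ε (x k) - δ • energyGrad A b ε (x k)) :
    ∃ xs ∈ X0 A b ε, Tendsto x atTop (𝓝 xs) := by
  have hstep : ∀ u ∈ X0 A b ε, ∀ k, δ * (energy A b ε (x (k + 1)) - energy A b ε u)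
      ≤ relDiv ε u (x k) - relDiv ε u (x (k + 1)) := by
    intro u hu k
    have h1 := relDiv_le_of_step hε hδ hA hsurj hb hL (mem_X0_iff.1 hu).1 (hx k) (hx (k + 1)) (h k)
    have h2 := mul_nonneg (sub_nonneg.2 hδL)
      (relDiv_nonneg hε (mem_orthant_of_pos (hx (k + 1))) (hx k))
    linarith
  have hmono : ∀ u ∈ X0 A b ε, Antitone fun k => relDiv ε u (x k) := by
    intro u hu
    refine antitone_nat_of_succ_le fun k => ?_
    have h1 := hstep u hu k
    have h2 := mul_nonneg hδ.le
      (sub_nonneg.2 ((mem_X0_iff.1 hu).2 _ (mem_orthant_of_pos (hx (k + 1)))))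
    linarith
  have hbdd : ∀ u ∈ X0 A b ε, BddBelow (Set.range fun k => relDiv ε u (x k)) := by
    intro u hu
    refine ⟨0, ?_⟩
    rintro _ ⟨k, rfl⟩
    exact relDiv_nonneg hε (mem_X0_iff.1 hu).1 (hx k)
  obtain ⟨u, hu⟩ := X0_nonempty (n := n) (A := A) hε hA hb
  have huo := (mem_X0_iff.1 hu).1
  -- The energy gap is squeezed by consecutive differences of a convergent monotone sequence.
  have hE : Tendsto (fun k => energy A b ε (x (k + 1))) atTop (𝓝 (energy A b ε u)) := by
    have h1 := tendsto_atTop_ciInf (hmono u hu) (hbdd u hu)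
    have h2 := h1.sub (h1.comp (tendsto_add_atTop_nat 1))
    rw [sub_self] at h2
    have h3 : Tendsto (fun k => δ * (energy A b ε (x (k + 1)) - energy A b ε u)) atTop (𝓝 0) :=
      squeeze_zero (fun k => mul_nonneg hδ.le
        (sub_nonneg.2 ((mem_X0_iff.1 hu).2 _ (mem_orthant_of_pos (hx (k + 1))))))
        (hstep u hu) h2
    have h4 := (h3.const_mul δ⁻¹).add_const (energy A b ε u)
    simpa [← mul_assoc, inv_mul_cancel₀ hδ.ne'] using h4
  have hbox : ∀ k, x k ∈ {z : Vec n | ∀ i, z i ∈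
      Set.Icc 0 ((√(u i) + √(relDiv ε u (x 0))) ^ 2)} := by
    intro k i
    refine ⟨(hx k i).le, le_sq_of_sq_sqrt_sub_le (hx k i).le ?_⟩
    rw [← neg_sub, neg_sq]
    exact (sq_sqrt_sub_le_relDiv hε huo (hx k) i).trans (hmono u hu (Nat.zero_le k))
  obtain ⟨xs, -, φ, hφ, hlim⟩ := (isCompact_box _).tendsto_subseq fun k => hbox (k + 1)
  have hxs : xs ∈ X0 A b ε := by
    have hEs : energy A b ε xs = energy A b ε u :=
      tendsto_nhds_unique (((continuous_energy A ε hb).tendsto xs).comp hlim)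
        (hE.comp hφ.tendsto_atTop)
    refine mem_X0_iff.2 ⟨(isClosed_orthant n).mem_of_tendsto hlim
      (Eventually.of_forall fun k => mem_orthant_of_pos (hx _)), fun z hz => ?_⟩
    rw [hEs]
    exact (mem_X0_iff.1 hu).2 z hz
  refine ⟨xs, hxs, tendsto_of_tendsto_relDiv hε (mem_X0_iff.1 hxs).1 hx ?_⟩
  -- The divergence from the cluster point `xs` is itself monotone, and it tends to `0` along the
  -- subsequence, hence along the whole sequence.
  have h1 := tendsto_atTop_ciInf (hmono xs hxs) (hbdd xs hxs)
  have h2 := tendsto_relDiv_of_tendsto ε hlim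
  have h3 := h1.comp ((tendsto_add_atTop_nat 1).comp hφ.tendsto_atTop)
  rwa [tendsto_nhds_unique h3 h2] at h1

theorem tendsto_relGrad {n : ℕ} (ε : ℝ) {x : ℕ → Vec n} {u : Vec n} (hu : ∀ i, 0 < u i)
    (h : Tendsto x atTop (𝓝 u)) : Tendsto (fun k => relGrad ε (x k)) atTop (𝓝 (relGrad ε u)) := by
  have h1 : Tendsto (fun k => (relGrad ε (x k)).ofLp) atTop (𝓝 (relGrad ε u).ofLp) := by
    refine tendsto_pi_nhds.2 fun i => ?_
    have hi : Tendsto (fun k => x k i) atTop (𝓝 (u i)) :=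
      ((by fun_prop : Continuous fun y : Vec n => y i).tendsto u).comp h
    exact ((((Real.continuousAt_log (hu i).ne').tendsto.comp hi).add_const 1).add
      (hi.const_mul ε))
  exact ((PiLp.continuous_toLp 2 fun _ : Fin n => ℝ).tendsto (relGrad ε u).ofLp).comp h1

/-- The optimality condition for the regularized problem at interior minimizers of the energy. -/
theorem regObj_le_of_relGrad_mem_range {m n : ℕ} {A : Matrix (Fin m) (Fin n) ℝ} {b : Vec m}
    {ε μ δ : ℝ} (hε : 0 ≤ ε) (hδ : 0 < δ) (hA : ∀ i j, 0 ≤ A i j) (hb : ∀ i, 0 < b i)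
    {x z : Vec n} (hx : x ∈ X0 A b ε) (hpos : ∀ i, 0 < x i) (hz : z ∈ X0 A b ε)
    (h : relGrad ε x + (δ * μ) • (WithLp.toLp 2 fun _ => 1 : Vec n)
      ∈ (ContinuousLinearMap.adjoint (linOp A)).range) :
    regObj ε μ δ x ≤ regObj ε μ δ z := by
  obtain ⟨w, hw⟩ := h
  -- `z - x` lies in `ker A`, the orthogonal complement of the range of the adjoint.
  have h1 : inner ℝ (ContinuousLinearMap.adjoint (linOp A) w) (z - x) = (0 : ℝ) := by
    rw [ContinuousLinearMap.adjoint_inner_left, map_sub, linOp_eq_of_mem_X0 hε hA hb hz hx,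
      sub_self, inner_zero_right]
  have h2 := relFun_eq_add_relDiv ε z x
  have hzo := (mem_X0_iff.1 hz).1
  have h3 := relDiv_nonneg hε hzo hpos
  refine le_of_mul_le_mul_left ?_ hδ
  rw [mul_regObj ε μ hδ (mem_X0_iff.1 hx).1, mul_regObj ε μ hδ hzo]
  rw [show ContinuousLinearMap.adjoint (linOp A) w = _ from hw] at h1
  simp only [inner_add_left, inner_sub_right, real_inner_smul_left] at h1 h2 ⊢
  linarith

/-! ### The iteration -/

theorem intGrad_energy_mem_range {m n : ℕ} {A : Matrix (Fin m) (Fin n) ℝ} {b : Vec m} {ε : ℝ}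
    (hA : ∀ i j, 0 ≤ A i j) (hsurj : Function.Surjective (linOp A)) (hb : ∀ i, 0 < b i)
    (x : Vec n) :
    intGrad (energy A b ε) x ∈ (ContinuousLinearMap.adjoint (linOp A)).range := by
  rw [intGrad]
  split_ifs with hx
  · rw [(hasGradientAt_energy ε hb (linOp_pos hA hsurj (mem_interior_orthant.1 hx))).gradient]
    exact ⟨_, rfl⟩
  · exact Submodule.zero_mem _

/-- The vector `∇h(xᵏ) + δ μ pᵏ`, which the iteration updates by the gradient of the energy. -/
def dualVar {n : ℕ} (ε μ δ : ℝ) (x p : Vec n) : Vec n :=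
  intGrad (relFun ε) x + (δ * μ) • p

theorem IsStart.dualVar_eq_zero {n : ℕ} {ε μ δ : ℝ} {x p : Vec n} (h : IsStart ε μ δ x p) :
    dualVar ε μ δ x p = 0 := by
  rcases h with ⟨rfl, rfl⟩ | ⟨hx, h⟩
  -- For `n = 0` the origin is interior, so the convention of `intGrad` does not apply; the space is
  -- then trivial.
  · rcases Nat.eq_zero_or_pos n with rfl | hn
    · exact Subsingleton.elim _ _
    · have h0 : (0 : Vec n) ∉ interior (orthant n) := fun h0 =>
        lt_irrefl _ (mem_interior_orthant.1 h0 ⟨0, hn⟩)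
      rw [dualVar, intGrad, if_neg h0, smul_zero, add_zero]
  · rw [dualVar, intGrad, if_pos hx, h]

theorem IsGenerated.dualVar_succ {m n : ℕ} {A : Matrix (Fin m) (Fin n) ℝ} {b : Vec m}
    {ε μ δ : ℝ} (hμ : 0 < μ) (hδ : 0 < δ) {x p : ℕ → Vec n} (h : IsGenerated A b ε μ δ x p)
    (k : ℕ) : dualVar ε μ δ (x (k + 1)) (p (k + 1))
      = dualVar ε μ δ (x k) (p k) - δ • intGrad (energy A b ε) (x k) := by
  have hne : δ * μ ≠ 0 := (mul_pos hδ hμ).ne'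
  rw [dualVar, dualVar, (h k).2, smul_sub, smul_smul, mul_one_div_cancel hne, one_smul]
  abel

/-- Strict minimality identifies `x (k + 1)` with the positive solution of the stationarity
equation, whose right-hand side is the updated dual variable shifted by `δμ·1`. -/
theorem IsGenerated.relGrad_succ {m n : ℕ} {A : Matrix (Fin m) (Fin n) ℝ} {b : Vec m}
    {ε μ δ : ℝ} (hε : 0 ≤ ε) (hμ : 0 < μ) (hδ : 0 < δ) {x p : ℕ → Vec n}
    (h : IsGenerated A b ε μ δ x p) (k : ℕ) :
    (∀ i, 0 < x (k + 1) i) ∧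
      relGrad ε (x (k + 1)) = dualVar ε μ δ (x (k + 1)) (p (k + 1))
        - (δ * μ) • (WithLp.toLp 2 fun _ => 1 : Vec n) := by
  obtain ⟨z, hz, hgrad, hmin⟩ := exists_subObj_minimizer μ δ hε (pbar A b ε μ δ (x k) (p k))
  have hxz : x (k + 1) = z := by
    by_contra hne
    exact absurd ((h k).1.2 z (mem_orthant_of_pos hz)) (not_le.2 (hmin _ (h k).1.1 hne))
  rw [h.dualVar_succ hμ hδ, hxz, hgrad]
  refine ⟨hz, ?_⟩
  rw [pbar, dualVar]
  abel

theorem IsGenerated.dualVar_mem_range {m n : ℕ} {A : Matrix (Fin m) (Fin n) ℝ} {b : Vec m}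
    {ε μ δ : ℝ} (hμ : 0 < μ) (hδ : 0 < δ) (hA : ∀ i j, 0 ≤ A i j)
    (hsurj : Function.Surjective (linOp A)) (hb : ∀ i, 0 < b i) {x p : ℕ → Vec n}
    (hs : IsStart ε μ δ (x 0) (p 0)) (h : IsGenerated A b ε μ δ x p) (k : ℕ) :
    dualVar ε μ δ (x k) (p k) ∈ (ContinuousLinearMap.adjoint (linOp A)).range := by
  induction k with
  | zero => rw [hs.dualVar_eq_zero]; exact Submodule.zero_mem _
  | succ k ih =>
    rw [h.dualVar_succ hμ hδ]
    exact Submodule.sub_mem _ ih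
      (Submodule.smul_mem _ _ (intGrad_energy_mem_range hA hsurj hb _))

end LBreg

end

theorem mainTheorem7 {m n : ℕ} (A : Matrix (Fin m) (Fin n) ℝ) (b : LBreg.Vec m) (ε μ δ : ℝ)
    (hA : ∀ i j, 0 ≤ A i j) (hsurj : Function.Surjective (LBreg.linOp A))
    (hb : ∀ i, 0 < b i) (hε : 0 ≤ ε) (hμ : 0 < μ) (hδ : 0 < δ) :
    (∀ L : ℝ, 0 < L → ‖LBreg.linOp A‖ ^ 2 ≤ L → (∀ j, ∑ i, A i j ≤ L) →
      LBreg.LipschitzLike A b ε L) ∧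
    (∀ q : LBreg.Vec n, ∃ z ∈ interior (LBreg.orthant n), ∀ w ∈ LBreg.orthant n, w ≠ z →
      LBreg.subObj ε μ δ q z < LBreg.subObj ε μ δ q w) ∧
    ∃ xhat ∈ LBreg.X0 A b ε,
      (∀ z ∈ LBreg.X0 A b ε, z ≠ xhat → LBreg.regObj ε μ δ xhat < LBreg.regObj ε μ δ z) ∧
      ∀ L : ℝ, 0 < L → LBreg.LipschitzLike A b ε L →
        (∃ ω ∈ Set.Ioo 0 (1 + LBreg.symCoeff n ε), δ < (1 + LBreg.symCoeff n ε - ω) / L) →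
        ∀ x p : ℕ → LBreg.Vec n, LBreg.IsStart ε μ δ (x 0) (p 0) →
          LBreg.IsGenerated A b ε μ δ x p →
          Filter.Tendsto x Filter.atTop (nhds xhat) ∨
            ∃ xs ∈ frontier (LBreg.orthant n), Filter.Tendsto x Filter.atTop (nhds xs) := by
  open LBreg Filter Topology in
  refine ⟨fun L _ h1 h2 => lipschitzLike_of_le hε hA hsurj hb h1 h2, fun q => ?_, ?_⟩
  · obtain ⟨z, hz, -, h⟩ := exists_subObj_minimizer μ δ hε q
    exact ⟨z, mem_interior_orthant.2 hz, h⟩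
  obtain ⟨xhat, hxhat, hmin⟩ := exists_regObj_minimizer (A := A) (n := n) μ hε hδ hA hb
  refine ⟨xhat, hxhat, hmin, ?_⟩
  rintro L hLpos hL ⟨ω, hω, hδω⟩ x p hs h
  -- `α(h) ≤ 0` and `ω > 0` give `1 + α(h) - ω < 1`.
  have hδL : δ * L ≤ 1 := by
    rw [lt_div_iff₀ hLpos] at hδω
    have := symCoeff_nonpos n hε
    have := hω.1
    linarith
  have hpos : ∀ k i, 0 < x (k + 1) i := fun k => (h.relGrad_succ hε hμ hδ k).1
  -- The shift by one discards `x 0`, which may be the origin; every later iterate is interior.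
  obtain ⟨xs, hxs, hlim⟩ := exists_tendsto_of_step (x := fun k => x (k + 1)) hε hδ hA hsurj hb hL
    hδL hpos fun k => by
      rw [(h.relGrad_succ hε hμ hδ (k + 1)).2, (h.relGrad_succ hε hμ hδ k).2,
        h.dualVar_succ hμ hδ (k + 1), intGrad, if_pos (mem_interior_orthant.2 (hpos k)),
        (hasGradientAt_energy ε hb (linOp_pos hA hsurj (hpos k))).gradient]
      abel
  have hlim' : Tendsto x atTop (𝓝 xs) := (tendsto_add_atTop_iff_nat 1).1 hlim
  have hxso := (mem_X0_iff.1 hxs).1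
  by_cases hint : xs ∈ interior (orthant n)
  · left
    rw [mem_interior_orthant] at hint
    have hclosed : IsClosed ((ContinuousLinearMap.adjoint (linOp A)).range : Set (Vec n)) :=
      Submodule.closed_of_finiteDimensional _
    -- An interior limit is needed here: `relGrad` is continuous only at positive points.
    have hmem := hclosed.mem_of_tendsto
      ((tendsto_relGrad ε hint hlim).add_const ((δ * μ) • (WithLp.toLp 2 fun _ => 1 : Vec n)))
      (Eventually.of_forall fun k => by
        rw [(h.relGrad_succ hε hμ hδ k).2, sub_add_cancel]
        exact h.dualVar_mem_range hμ hδ hA hsurj hb hs (k + 1))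
    have hle := regObj_le_of_relGrad_mem_range hε hδ hA hb hxs hint hxhat hmem
    have heq : xs = xhat := by
      by_contra hne
      exact absurd hle (not_le.2 (hmin xs hxs hne))
    rwa [← heq]
  · right
    refine ⟨xs, ?_, hlim'⟩
    rw [(isClosed_orthant n).frontier_eq]
    exact ⟨hxso, hint⟩
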